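/- **Setting.** Let $\Sigma$ be a finite set of events, $\checkmark\notin\Sigma$. CSP terms are given by $$P ::= STOP \mid a\to P \mid SKIP \mid P_1\sqcap P_2 \mid P_1\mathbin{\square} P_2 \mid P_1\parallel_A P_2 \mid P_1;P_2 \mid P\setminus A \mid P[R] \mid X \mid \mu X.P \mid DIV,$$ with $a\in\Sigma$, $A\subseteq\Sigma$, $R\subseteq\Sigma\times\Sigma$, $X$ a process variable; $\mu X$ binds $X$, and a term is closed if it has no free variable. **Semantics.** Let $\Sigma^{*\checkmark}$ be the set of finite sequences over $\Sigma$, possibly followed by $\checkmark$. The model $\mathcal T$ is the set of pairs $(T,D)$ with $D\subseteq T\subseteq\Sigma^{*\checkmark}$, $T$ non-empty and prefix-closed, $s\langle\checkmark\rangle\in D\Rightarrow s\in D$, and $s\in D\cap\Sigma^*,\ t\in\Sigma^{*\checkmark}\Rightarrow st\in D$. It is ordered by reverse inclusion in both components and is a complete lattice. A term denotes, for given values in $\mathcal T$ of its variables, an element $(T(P),D(P))$ of $\mathcal T$ ($T$: traces, including divergences; $D$: divergences). Always $D(P)\subseteq T(P)$, and, with $r$ ranging over $\Sigma^{*\checkmark}$: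 - $STOP$: $T=\{\langle\rangle\}$, $D=\emptyset$. $SKIP$: $T=\{\langle\rangle,\langle\checkmark\rangle\}$, $D=\emptyset$. $DIV$: $T=D=\Sigma^{*\checkmark}$. - $a\to P$: $T=\{\langle\rangle\}\cup\{\langle a\rangle t: t\in T(P)\}$, $D=\{\langle a\rangle t:t\in D(P)\}$. - $P\sqcap Q$ and $P\mathbin\square Q$: componentwise unions. - $P;Q$: $D=D(P)\cup\{ts: t\langle\checkmark\rangle\in T(P), s\in D(Q)\}$, $T=(T(P)\cap\Sigma^*)\cup\{ts:t\langle\checkmark\rangle\in T(P),s\in T(Q)\}\cup D$. - $P\parallel_A Q$: $D=\{ur: u\in (s\parallel_A t)\cap\Sigma^*,\ s\in T(P),\ t\in T(Q),\ (s\in D(P)\text{ or }t\in D(Q))\}$, $T=\bigcup\{s\parallel_A t: s\in T(P),t\in T(Q)\}\cup D$, where $s\parallel_A t$ is the set of merges of $s$ and $t$ that synchronise on exactly the events of $A\cup\{\checkmark\}$. - $P\setminus A$: $D$ consists of the traces $(t{\restriction}(\Sigma\setminus A))\,r$ with $t\in D(P)\cap\Sigma^*$, or with $t\in\Sigma^\omega$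 such that $t{\restriction}(\Sigma\setminus A)$ is finite and all finite prefixes of $t$ are in $T(P)$; $T$ is obtained from $T(P)$ by deleting the events of $A$ from every trace, together with $D$. - $P[R]$: $D=\{tr: \exists s\in D(P)\cap\Sigma^*,\ s\mathrel R t\}$, $T=\{t:\exists s\in T(P),\ s\mathrel R t\}\cup D$, with $R$ applied elementwise and $\checkmark\mathrel R\checkmark$. - $X$ denotes its given value, and $\mu X.P$ denotes the least fixed point of the map that $P$ induces on $\mathcal T$ as a function of $X$. A closed term $P$ is *livelock-free* if $D(P)=\emptyset$. **Static analysis.** Let $R(V)=\{y:\exists x\in V,\ x\mathrel R y\}$, and let $\mathcal P$ denote the power set. Put $N_X(P)=C_X(P)=\mathcal P(\Sigma)^2$ whenever $X$ is not free in $P$. Otherwise (and, for the other two functions, always) define by recursion on the syntax, $C_X$, $G$ and $F$ simultaneously: Nonexpansive sets $N_X(P)\subseteq\mathcal P(\Sigma)^2$: - $N_X(a\to P)=N_X(P)$, and $N_X(P_1\oplus P_2)=N_X(P_1)\cap N_X(P_2)$ for $\oplus\in\{\sqcap,\square,;,\parallel_A\}$. - $N_X(P\setminus A)=\{(U,V):\exists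 V'\subseteq V,\ (U,V')\in N_X(P),\ V'\cap A=\emptyset\}$. - $N_X(P[R])=\{(U,V):\exists V',\ (U,V')\in N_X(P),\ R(V')\subseteq V\}$. - $N_X(X)=\{(U,V):U\subseteq V\}$. - $N_X(\mu Y.P)=\{(U,V):\exists U'\supseteq U,\ V'\subseteq V,\ (U',V')\in N_X(P),\ (V',V')\in N_Y(P)\}$. Guard sets $G(P)\subseteq\mathcal P(\Sigma)$: - $G(STOP)=\mathcal P(\Sigma)$, $G(SKIP)=G(X)=\emptyset$, $G(a\to P)=G(P)\cup\{V:a\in V\}$, $G(\mu X.P)=G(P)$, and $G(P_1\oplus P_2)=G(P_1)\cap G(P_2)$ for $\oplus\in\{\sqcap,\square\}$. - $G(P_1;P_2)=G(P_1)\cup G(P_2)$ if $P_1$ is closed and $F(P_1)\ne\emptyset$, and $G(P_1)$ otherwise. - $G(P_1\parallel_A P_2)=G(P_1)\cup G(P_2)$ if $P_1,P_2$ are closed and $F(P_1)\neq\emptyset\ne F(P_2)$, and $G(P_1)\cap G(P_2)$ otherwise. - $G(P\setminus A)=\{V:\exists V'\subseteq V,\ V'\in G(P),\ V'\cap A=\emptyset\}$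 if $P$ is closed and $(\emptyset,\Sigma\setminus A)\in F(P)$, and $\emptyset$ otherwise. - $G(P[R])=\{V:\exists V'\in G(P),\ R(V')\subseteq V\}$. Contractive sets $C_X(P)\subseteq\mathcal P(\Sigma)^2$: - $C_X(a\to P)=C_X(P)\cup\{(U,V)\in N_X(P):a\in V\}$, $C_X(X)=\emptyset$, and $C_X(P_1\oplus P_2)=C_X(P_1)\cap C_X(P_2)$ for $\oplus\in\{\sqcap,\square,\parallel_A\}$. - $C_X(P_1;P_2)=C_X(P_1)\cap\bigl(C_X(P_2)\cup\{(U,V)\in N_X(P_2):V\in G(P_1)\}\bigr)$. - $C_X(P\setminus A)=\{(U,V):\exists V'\subseteq V,\ (U,V')\in C_X(P),\ V'\cap A=\emptyset\}$. - $C_X(P[R])=\{(U,V):\exists V',\ (U,V')\in C_X(P),\ R(V')\subseteq V\}$. - $C_X(\mu Y.P)=\{(U,V):\exists U'\supseteq U,\ V'\subseteq V,\ (U',V')\in C_X(P),\ (V',V')\in N_Y(P)\}$. Fair sets $F(P)\subseteq\mathcal P(\Sigma)^2$: - $F(STOP)=F(SKIP)=\mathcal P(\Sigma)^2$, $F(a\to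 P)=F(P)$, $F(X)=\{(U,V):U\subseteq V\}$, and $F(P_1\oplus P_2)=F(P_1)\cap F(P_2)$ for $\oplus\in\{\sqcap,\square,;\}$. - $F(P_1\parallel_A P_2)=(F(P_1)\cap F(P_2))\cup\{(U_1\cap U_2,V_1):(U_1,V_1)\in F(P_1),(U_2,A)\in F(P_2)\}\cup\{(U_1\cap U_2,V_2):(U_2,V_2)\in F(P_2),(U_1,A)\in F(P_1)\}$. - $F(P\setminus A)=\{(U,V):\exists V'\subseteq V,\ (U,V')\in F(P),\ V'\cap A=\emptyset\}$. - $F(P[R])=\{(U,V):\exists V',\ (U,V')\in F(P),\ R(V')\subseteq V\}$. - $F(\mu X.P)=\{(U,V):\exists W,\ (W,W)\in C_X(P)\cap F(P),\ U\subseteq W\subseteq V\}$ if $\mu X.P$ is open, and $\{(U,V):\exists W\subseteq V,\ (W,W)\in C_X(P)\cap F(P)\}$ if it is closed. (For terms containing $DIV$ one may put $G(DIV)=F(DIV)=\emptyset$; this plays no role below.) **Theorem.** Let $P$ be a closed CSP term in which $DIV$ does not occur. If $F(P)\neq\emptyset$, then $P$ is livelock-free, i.e. $D(P)=\emptyset$.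 -/

import Mathlib

namespace CSP

universe u v

/-! ### Syntax -/

/-- CSP terms over the alphabet `α` of events (which does not contain the termination event)
and the set `ν` of process variables. -/
inductive Term (α : Type u) (ν : Type v) : Type (max u v) where
  | STOP : Term α ν
  | pre (a : α) (P : Term α ν) : Term α ν
  | SKIP : Term α ν
  | intChoice (P Q : Term α ν) : Term α ν
  | extChoice (P Q : Term α ν) : Term α ν
  | par (A : Set α) (P Q : Term α ν) : Term α ν
  | seq (P Q : Term α ν) : Term α ν
  | hide (P : Term α ν) (A : Set α) : Term α ν
  | rename (P : Term α ν) (R : α → α → Prop) : Term α ν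
  | var (X : ν) : Term α ν
  | mu (X : ν) (P : Term α ν) : Term α ν
  | DIV : Term α ν

namespace Term

variable {α : Type u} {ν : Type v}

/-- The set of free variables of a term. -/
def freeVars : Term α ν → Set ν
  | STOP => ∅
  | pre _ P => P.freeVars
  | SKIP => ∅
  | intChoice P Q => P.freeVars ∪ Q.freeVars
  | extChoice P Q => P.freeVars ∪ Q.freeVars
  | par _ P Q => P.freeVars ∪ Q.freeVars
  | seq P Q => P.freeVars ∪ Q.freeVars
  | hide P _ => P.freeVars
  | rename P _ => P.freeVars
  | var X => {X}
  | mu X P => P.freeVars \ {X}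
  | DIV => ∅

/-- A term is closed if it has no free variable. Closed terms are the CSP processes. -/
def IsClosed (P : Term α ν) : Prop := P.freeVars = ∅

/-- `DIV` does not occur in the term. -/
def DivFree : Term α ν → Prop
  | STOP => True
  | pre _ P => P.DivFree
  | SKIP => True
  | intChoice P Q => P.DivFree ∧ Q.DivFree
  | extChoice P Q => P.DivFree ∧ Q.DivFree
  | par _ P Q => P.DivFree ∧ Q.DivFree
  | seq P Q => P.DivFree ∧ Q.DivFree
  | hide P _ => P.DivFree
  | rename P _ => P.DivFree
  | var _ => True
  | mu _ P => P.DivFree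
  | DIV => False

end Term

/-! ### Traces -/

/-- A finite trace: a finite sequence of events, possibly followed by the termination event
(which is present exactly when `tick = true`). -/
@[ext]
structure Trace (α : Type u) : Type u where
  evs : List α
  tick : Bool

namespace Trace

variable {α : Type u}

/-- The empty trace. -/
def nil : Trace α := ⟨[], false⟩

/-- Concatenation of a trace without termination event and an arbitrary trace. -/
def cat (s : List α) (t : Trace α) : Trace α := ⟨s ++ t.evs, t.tick⟩

/-- `s` is a (not necessarily strict) prefix of `t`. -/
def IsPrefix (s t : Trace α) : Prop := s = t ∨ (s.tick = false ∧ s.evs <+: t.evs)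

end Trace

section Lists

variable {α : Type u}

open Classical in
/-- Restriction of a sequence of events to the complement of `A`. -/
noncomputable def hideList (A : Set α) (s : List α) : List α := s.filter (fun a => a ∉ A)

/-- The prefix of length `n` of an infinite sequence of events. -/
def prefixOf (w : ℕ → α) (n : ℕ) : List α := (List.range n).map w

/-- `Interleave A s t w`: the sequence `w` is a merge of `s` and `t` in which the events of `A`
are performed jointly and all other events independently. -/
inductive Interleave (A : Set α) : List α → List α → List α → Prop
  | nil : Interleave A [] [] []
  | sync {a : α} {s t w : List α} (ha : a ∈ A) (h : Interleave A s t w) :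
      Interleave A (a :: s) (a :: t) (a :: w)
  | left {b : α} {s t w : List α} (hb : b ∉ A) (h : Interleave A s t w) :
      Interleave A (b :: s) t (b :: w)
  | right {b : α} {s t w : List α} (hb : b ∉ A) (h : Interleave A s t w) :
      Interleave A s (b :: t) (b :: w)

theorem Interleave.exists_prefix {A : Set α} {s t w : List α} (h : Interleave A s t w) :
    ∀ {w' : List α}, w' <+: w → ∃ s' t', s' <+: s ∧ t' <+: t ∧ Interleave A s' t' w' := by
  induction h with
  | nil =>
    intro w' hw
    rw [List.prefix_nil] at hw
    subst hw
    exact ⟨[], [], List.nil_prefix, List.nil_prefix, .nil⟩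
  | sync ha h ih =>
    intro w' hw
    rcases List.prefix_cons_iff.1 hw with rfl | ⟨v, rfl, hv⟩
    · exact ⟨[], [], List.nil_prefix, List.nil_prefix, .nil⟩
    · obtain ⟨s', t', hs, ht, hi⟩ := ih hv
      exact ⟨_, _, List.cons_prefix_cons.2 ⟨rfl, hs⟩, List.cons_prefix_cons.2 ⟨rfl, ht⟩,
        .sync ha hi⟩
  | left hb h ih =>
    intro w' hw
    rcases List.prefix_cons_iff.1 hw with rfl | ⟨v, rfl, hv⟩
    · exact ⟨[], [], List.nil_prefix, List.nil_prefix, .nil⟩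
    · obtain ⟨s', t', hs, ht, hi⟩ := ih hv
      exact ⟨_, _, List.cons_prefix_cons.2 ⟨rfl, hs⟩, ht, .left hb hi⟩
  | right hb h ih =>
    intro w' hw
    rcases List.prefix_cons_iff.1 hw with rfl | ⟨v, rfl, hv⟩
    · exact ⟨[], [], List.nil_prefix, List.nil_prefix, .nil⟩
    · obtain ⟨s', t', hs, ht, hi⟩ := ih hv
      exact ⟨_, _, hs, List.cons_prefix_cons.2 ⟨rfl, ht⟩, .right hb hi⟩

theorem hideList_prefix {A : Set α} {s w : List α} (h : w <+: hideList A s) :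
    ∃ s', s' <+: s ∧ hideList A s' = w := by
  classical
  induction s generalizing w with
  | nil =>
    rw [hideList, List.filter_nil, List.prefix_nil] at h
    exact ⟨[], List.nil_prefix, by simp [hideList, h]⟩
  | cons a s ih =>
    by_cases ha : a ∈ A
    · obtain ⟨s', hs, he⟩ := ih (w := w) (by simpa [hideList, ha] using h)
      exact ⟨a :: s', List.cons_prefix_cons.2 ⟨rfl, hs⟩, by
        rw [← he]; simp [hideList, ha]⟩
    · have h' : w <+: a :: hideList A s := by simpa [hideList, ha] using h
      rcases List.prefix_cons_iff.1 h' with rfl | ⟨v, rfl, hv⟩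
      · exact ⟨[], List.nil_prefix, by simp [hideList]⟩
      · obtain ⟨s', hs, he⟩ := ih hv
        exact ⟨a :: s', List.cons_prefix_cons.2 ⟨rfl, hs⟩, by
          rw [← he]; simp [hideList, ha]⟩

theorem forall₂_prefix {R : α → α → Prop} {s t w : List α} (h : List.Forall₂ R s t)
    (hw : w <+: t) : ∃ s', s' <+: s ∧ List.Forall₂ R s' w := by
  induction h generalizing w with
  | nil =>
    rw [List.prefix_nil] at hw
    subst hw
    exact ⟨[], List.nil_prefix, .nil⟩
  | cons hab h ih =>
    rcases List.prefix_cons_iff.1 hw with rfl | ⟨v, rfl, hv⟩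
    · exact ⟨[], List.nil_prefix, .nil⟩
    · obtain ⟨s', hs, hi⟩ := ih hv
      exact ⟨_, List.cons_prefix_cons.2 ⟨rfl, hs⟩, .cons hab hi⟩

end Lists

theorem Trace.isPrefix_cat {α : Type u} {w : Trace α} {s : List α} {r : Trace α}
    (h : w.IsPrefix (.cat s r)) :
    (w.tick = false ∧ w.evs <+: s) ∨ ∃ r', r'.IsPrefix r ∧ w = .cat s r' := by
  rcases h with rfl | ⟨ht, hp⟩
  · exact .inr ⟨r, .inl rfl, rfl⟩
  · rcases List.prefix_or_prefix_of_prefix hp (List.prefix_append s r.evs) with h | h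
    · exact .inl ⟨ht, h⟩
    · obtain ⟨l, hl⟩ := h
      refine .inr ⟨⟨l, w.tick⟩, .inr ⟨ht, ?_⟩, ?_⟩
      · rw [← hl] at hp
        exact (List.prefix_append_right_inj s).1 hp
      · ext1
        · exact hl.symm
        · rfl

/-! ### The semantic model -/

/-- The model: pairs consisting of a set `traces` of traces and a set `divs` of divergences,
subject to the usual healthiness conditions. Divergence is catastrophic, and `traces` contains
the divergences. -/
@[ext]
structure Model (α : Type u) : Type u where
  traces : Set (Trace α)
  divs : Set (Trace α)
  divs_subset : divs ⊆ traces
  divs_of_tick : ∀ s : List α, ⟨s, true⟩ ∈ divs → ⟨s, false⟩ ∈ divs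
  nonempty : traces.Nonempty
  prefix_closed : ∀ s t : Trace α, t ∈ traces → s.IsPrefix t → s ∈ traces
  divs_extend : ∀ s : List α, ⟨s, false⟩ ∈ divs → ∀ t : Trace α, .cat s t ∈ divs

namespace Model

variable {α : Type u}

theorem nil_mem (M : Model α) : Trace.nil ∈ M.traces := by
  obtain ⟨t, ht⟩ := M.nonempty
  exact M.prefix_closed _ t ht (.inr ⟨rfl, List.nil_prefix⟩)

/-- `M ≤ N` is reverse inclusion in both components. -/
instance : PartialOrder (Model α) where
  le M N := N.traces ⊆ M.traces ∧ N.divs ⊆ M.divs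
  le_refl M := ⟨subset_rfl, subset_rfl⟩
  le_trans M N K h h' := ⟨h'.1.trans h.1, h'.2.trans h.2⟩
  le_antisymm M N h h' := Model.ext (h'.1.antisymm h.1) (h'.2.antisymm h.2)

/-- Least upper bounds are componentwise intersections. -/
instance : SupSet (Model α) where
  sSup S :=
    { traces := ⋂ M ∈ S, M.traces
      divs := ⋂ M ∈ S, M.divs
      divs_subset := Set.iInter₂_mono fun M _ => M.divs_subset
      divs_of_tick := fun s hs => by
        simp only [Set.mem_iInter] at hs ⊢
        exact fun M hM => M.divs_of_tick s (hs M hM)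
      nonempty := ⟨.nil, by
        simp only [Set.mem_iInter]
        exact fun M _ => M.nil_mem⟩
      prefix_closed := fun s t ht h => by
        simp only [Set.mem_iInter] at ht ⊢
        exact fun M hM => M.prefix_closed s t (ht M hM) h
      divs_extend := fun s hs t => by
        simp only [Set.mem_iInter] at hs ⊢
        exact fun M hM => M.divs_extend s (hs M hM) t }

/-- The model is a complete lattice. -/
instance : CompleteLattice (Model α) :=
  completeLatticeOfSup (Model α) fun _ =>
    ⟨fun _ hM => ⟨Set.biInter_subset_of_mem hM, Set.biInter_subset_of_mem hM⟩,
     fun _ hN => ⟨Set.subset_iInter₂ fun _ hM => (hN hM).1,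
       Set.subset_iInter₂ fun _ hM => (hN hM).2⟩⟩

/-- The element of the model with divergences `s ⌢ r` (`s ∈ D₀`, `r` an arbitrary trace) whose
traces are those of `T₀` together with the divergences. -/
def generate (T₀ : Set (Trace α)) (D₀ : Set (List α)) (hne : T₀.Nonempty)
    (hpre : ∀ s t : Trace α, t ∈ T₀ → s.IsPrefix t → s ∈ T₀)
    (hD : ∀ s ∈ D₀, (⟨s, false⟩ : Trace α) ∈ T₀) : Model α where
  traces := T₀ ∪ {w | ∃ s ∈ D₀, ∃ r, w = .cat s r}
  divs := {w | ∃ s ∈ D₀, ∃ r, w = .cat s r}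
  divs_subset := Set.subset_union_right
  divs_of_tick := by
    rintro s ⟨s₀, hs₀, r, hr⟩
    refine ⟨s₀, hs₀, ⟨r.evs, false⟩, ?_⟩
    simp only [Trace.cat, Trace.mk.injEq] at hr ⊢
    exact ⟨hr.1, trivial⟩
  nonempty := hne.mono Set.subset_union_left
  prefix_closed := by
    rintro s t (ht | ⟨s₀, hs₀, r, rfl⟩) h
    · exact .inl (hpre s t ht h)
    · rcases Trace.isPrefix_cat h with ⟨h1, h2⟩ | ⟨r', -, rfl⟩
      · exact .inl (hpre s _ (hD s₀ hs₀) (.inr ⟨h1, h2⟩))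
      · exact .inr ⟨s₀, hs₀, r', rfl⟩
  divs_extend := by
    rintro s ⟨s₀, hs₀, r, hr⟩ t
    refine ⟨s₀, hs₀, .cat r.evs t, ?_⟩
    simp only [Trace.cat, Trace.mk.injEq] at hr ⊢
    simp [hr.1]

theorem generate_mono {T₀ T₁ : Set (Trace α)} {D₀ D₁ : Set (List α)} {h₁ h₂ h₃ h₄ h₅ h₆}
    (hT : T₁ ⊆ T₀) (hD : D₁ ⊆ D₀) :
    generate T₀ D₀ h₁ h₂ h₃ ≤ generate T₁ D₁ h₄ h₅ h₆ := by
  have h : {w | ∃ s ∈ D₁, ∃ r, w = Trace.cat s r} ⊆ {w | ∃ s ∈ D₀, ∃ r, w = Trace.cat s r} :=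
    fun w ⟨s, hs, r, hr⟩ => ⟨s, hD hs, r, hr⟩
  exact ⟨Set.union_subset_union hT h, h⟩

/-- The deadlocked process. -/
def STOP : Model α where
  traces := {.nil}
  divs := ∅
  divs_subset := Set.empty_subset _
  divs_of_tick := fun _ h => h
  nonempty := ⟨_, rfl⟩
  prefix_closed := by
    rintro s t rfl (h | ⟨h1, h2⟩)
    · exact h
    · exact Trace.ext (List.prefix_nil.1 h2) h1
  divs_extend := fun _ h => h.elim

/-- Successful termination. -/
def SKIP : Model α where
  traces := {.nil, ⟨[], true⟩}
  divs := ∅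
  divs_subset := Set.empty_subset _
  divs_of_tick := fun _ h => h
  nonempty := ⟨.nil, .inl rfl⟩
  prefix_closed := by
    rintro s t (rfl | rfl) (h | ⟨h1, h2⟩)
    · exact .inl h
    · exact .inl (Trace.ext (List.prefix_nil.1 h2) h1)
    · exact .inr h
    · exact .inl (Trace.ext (List.prefix_nil.1 h2) h1)
  divs_extend := fun _ h => h.elim

/-- The immediately divergent process. -/
def DIV : Model α where
  traces := Set.univ
  divs := Set.univ
  divs_subset := subset_rfl
  divs_of_tick := fun _ _ => trivial
  nonempty := ⟨.nil, trivial⟩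
  prefix_closed := fun _ _ _ _ => trivial
  divs_extend := fun _ _ _ => trivial

/-- Prefixing by the event `a`. -/
def pre (a : α) (M : Model α) : Model α where
  traces := {.nil} ∪ {w | ∃ t ∈ M.traces, w = .cat [a] t}
  divs := {w | ∃ t ∈ M.divs, w = .cat [a] t}
  divs_subset := fun _ ⟨t, ht, hw⟩ => .inr ⟨t, M.divs_subset ht, hw⟩
  divs_of_tick := by
    rintro s ⟨⟨t, b⟩, ht, hw⟩
    simp only [Trace.cat, Trace.mk.injEq] at hw
    obtain ⟨rfl, rfl⟩ := hw
    exact ⟨⟨t, false⟩, M.divs_of_tick t ht, rfl⟩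
  nonempty := ⟨.nil, .inl rfl⟩
  prefix_closed := by
    rintro s t (rfl | ⟨t, ht, rfl⟩) h
    · rcases h with h | ⟨h1, h2⟩
      · exact .inl h
      · exact .inl (Trace.ext (List.prefix_nil.1 h2) h1)
    · rcases Trace.isPrefix_cat h with ⟨h1, h2⟩ | ⟨r, hr, rfl⟩
      · rcases List.prefix_cons_iff.1 h2 with h3 | ⟨l, h3, h4⟩
        · exact .inl (Trace.ext h3 h1)
        · rw [List.prefix_nil] at h4
          subst h4
          exact .inr ⟨.nil, M.nil_mem, Trace.ext h3 h1⟩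
      · exact .inr ⟨r, M.prefix_closed r t ht hr, rfl⟩
  divs_extend := by
    rintro s ⟨⟨t, b⟩, ht, hw⟩ r
    simp only [Trace.cat, Trace.mk.injEq] at hw
    obtain ⟨rfl, rfl⟩ := hw
    exact ⟨.cat t r, M.divs_extend t ht r, rfl⟩

/-- Choice. Internal and external choice coincide in this model. -/
def choice (M N : Model α) : Model α where
  traces := M.traces ∪ N.traces
  divs := M.divs ∪ N.divs
  divs_subset := Set.union_subset_union M.divs_subset N.divs_subset
  divs_of_tick := fun s h => h.imp (M.divs_of_tick s) (N.divs_of_tick s)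
  nonempty := M.nonempty.mono Set.subset_union_left
  prefix_closed := fun s t ht h =>
    ht.imp (fun ht => M.prefix_closed s t ht h) (fun ht => N.prefix_closed s t ht h)
  divs_extend := fun s h t =>
    h.imp (fun h => M.divs_extend s h t) (fun h => N.divs_extend s h t)

/-- Sequential composition. -/
def seq (M N : Model α) : Model α where
  traces := {w | w ∈ M.traces ∧ w.tick = false} ∪
    {w | ∃ t s, ⟨t, true⟩ ∈ M.traces ∧ s ∈ N.traces ∧ w = .cat t s} ∪
    (M.divs ∪ {w | ∃ t s, ⟨t, true⟩ ∈ M.traces ∧ s ∈ N.divs ∧ w = .cat t s})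
  divs := M.divs ∪ {w | ∃ t s, ⟨t, true⟩ ∈ M.traces ∧ s ∈ N.divs ∧ w = .cat t s}
  divs_subset := Set.subset_union_right
  divs_of_tick := by
    rintro w (h | ⟨t, ⟨s, b⟩, ht, hs, hw⟩)
    · exact .inl (M.divs_of_tick w h)
    · simp only [Trace.cat, Trace.mk.injEq] at hw
      obtain ⟨rfl, rfl⟩ := hw
      exact .inr ⟨t, ⟨s, false⟩, ht, N.divs_of_tick s hs, rfl⟩
  nonempty := ⟨.nil, .inl (.inl ⟨M.nil_mem, rfl⟩)⟩
  prefix_closed := by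
    have key : ∀ (w : Trace α) (t : List α) (s : Trace α), ⟨t, true⟩ ∈ M.traces →
        s ∈ N.traces → w.IsPrefix (.cat t s) →
        (w ∈ M.traces ∧ w.tick = false) ∨
          ∃ t s, ⟨t, true⟩ ∈ M.traces ∧ s ∈ N.traces ∧ w = .cat t s := by
      intro w t s ht hs h
      rcases Trace.isPrefix_cat h with ⟨h1, h2⟩ | ⟨r, hr, rfl⟩
      · exact .inl ⟨M.prefix_closed w _ ht (.inr ⟨h1, h2⟩), h1⟩
      · exact .inr ⟨t, r, ht, N.prefix_closed r s hs hr, rfl⟩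
    rintro w w' ((⟨h', ht⟩ | ⟨t, s, ht, hs, rfl⟩) | (h' | ⟨t, s, ht, hs, rfl⟩)) h
    · refine .inl (.inl ⟨M.prefix_closed w w' h' h, ?_⟩)
      rcases h with rfl | h
      · exact ht
      · exact h.1
    · exact .inl (key w t s ht hs h)
    · rcases h with rfl | h
      · exact .inr (.inl h')
      · exact .inl (.inl ⟨M.prefix_closed w w' (M.divs_subset h') (.inr h), h.1⟩)
    · exact .inl (key w t s ht (N.divs_subset hs) h)
  divs_extend := by
    rintro w (h | ⟨t, ⟨s, b⟩, ht, hs, hw⟩) r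
    · exact .inl (M.divs_extend w h r)
    · simp only [Trace.cat, Trace.mk.injEq] at hw
      obtain ⟨rfl, rfl⟩ := hw
      exact .inr ⟨t, .cat s r, ht, N.divs_extend s hs r, by simp [Trace.cat]⟩

/-- Parallel composition, synchronising on the events of `A` and on termination. A divergence
arises after a joint trace at which one of the components diverges. -/
def par (A : Set α) (M N : Model α) : Model α :=
  generate
    {w | ∃ s t, ⟨s, w.tick⟩ ∈ M.traces ∧ ⟨t, w.tick⟩ ∈ N.traces ∧ Interleave A s t w.evs}
    {w | ∃ s t, ⟨s, false⟩ ∈ M.traces ∧ ⟨t, false⟩ ∈ N.traces ∧ Interleave A s t w ∧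
      (⟨s, false⟩ ∈ M.divs ∨ ⟨t, false⟩ ∈ N.divs)}
    ⟨.nil, [], [], M.nil_mem, N.nil_mem, .nil⟩
    (by
      rintro w w' ⟨s, t, hs, ht, hi⟩ (rfl | ⟨h1, h2⟩)
      · exact ⟨s, t, hs, ht, hi⟩
      · obtain ⟨s', t', hs', ht', hi'⟩ := hi.exists_prefix h2
        rw [Set.mem_ofPred_eq, h1]
        exact ⟨s', t', M.prefix_closed _ _ hs (.inr ⟨rfl, hs'⟩),
          N.prefix_closed _ _ ht (.inr ⟨rfl, ht'⟩), hi'⟩)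
    (fun _ ⟨s, t, hs, ht, hi, _⟩ => ⟨s, t, hs, ht, hi⟩)

/-- Hiding of the events of `A`. A divergence arises from a divergence of the argument, or from an
infinite sequence `w`, all of whose finite prefixes are traces of the argument, whose events are
in `A` from some position `n` on: then its restriction to the complement of `A` is
`hideList A (prefixOf w n)`. -/
def hide (M : Model α) (A : Set α) : Model α :=
  generate
    {w | ∃ t, ⟨t, w.tick⟩ ∈ M.traces ∧ w.evs = hideList A t}
    ({v | ∃ t, ⟨t, false⟩ ∈ M.divs ∧ v = hideList A t} ∪
      {v | ∃ (w : ℕ → α) (n : ℕ), (∀ i, n ≤ i → w i ∈ A) ∧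
        (∀ k, ⟨prefixOf w k, false⟩ ∈ M.traces) ∧ v = hideList A (prefixOf w n)})
    ⟨.nil, [], M.nil_mem, by simp [Trace.nil, hideList]⟩
    (by
      rintro w w' ⟨t, ht, he⟩ (rfl | ⟨h1, h2⟩)
      · exact ⟨t, ht, he⟩
      · rw [he] at h2
        obtain ⟨t', ht', he'⟩ := hideList_prefix h2
        rw [Set.mem_ofPred_eq, h1]
        exact ⟨t', M.prefix_closed _ _ ht (.inr ⟨rfl, ht'⟩), he'.symm⟩)
    (by
      rintro v (⟨t, ht, rfl⟩ | ⟨w, n, -, hw, rfl⟩)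
      · exact ⟨t, M.divs_subset ht, rfl⟩
      · exact ⟨_, hw n, rfl⟩)

/-- Renaming along the relation `R`, applied elementwise to traces; termination is kept. -/
def rename (M : Model α) (R : α → α → Prop) : Model α :=
  generate
    {w | ∃ s, ⟨s, w.tick⟩ ∈ M.traces ∧ List.Forall₂ R s w.evs}
    {w | ∃ s, ⟨s, false⟩ ∈ M.divs ∧ List.Forall₂ R s w}
    ⟨.nil, [], M.nil_mem, .nil⟩
    (by
      rintro w w' ⟨s, hs, hR⟩ (rfl | ⟨h1, h2⟩)
      · exact ⟨s, hs, hR⟩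
      · obtain ⟨s', hs', hR'⟩ := forall₂_prefix hR h2
        rw [Set.mem_ofPred_eq, h1]
        exact ⟨s', M.prefix_closed _ _ hs (.inr ⟨rfl, hs'⟩), hR'⟩)
    (fun _ ⟨s, hs, hR⟩ => ⟨s, M.divs_subset hs, hR⟩)

theorem pre_mono {a : α} {M M' : Model α} (h : M ≤ M') : pre a M ≤ pre a M' :=
  ⟨Set.union_subset_union subset_rfl fun _ ⟨t, ht, hw⟩ => ⟨t, h.1 ht, hw⟩,
    fun _ ⟨t, ht, hw⟩ => ⟨t, h.2 ht, hw⟩⟩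

theorem choice_mono {M M' N N' : Model α} (h : M ≤ M') (h' : N ≤ N') :
    choice M N ≤ choice M' N' :=
  ⟨Set.union_subset_union h.1 h'.1, Set.union_subset_union h.2 h'.2⟩

theorem seq_mono {M M' N N' : Model α} (h : M ≤ M') (h' : N ≤ N') : seq M N ≤ seq M' N' := by
  have hd : (seq M' N').divs ⊆ (seq M N).divs :=
    Set.union_subset_union h.2 fun _ ⟨t, s, ht, hs, hw⟩ => ⟨t, s, h.1 ht, h'.2 hs, hw⟩
  exact ⟨Set.union_subset_union (Set.union_subset_union (fun _ hw => ⟨h.1 hw.1, hw.2⟩)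
    fun _ ⟨t, s, ht, hs, hw⟩ => ⟨t, s, h.1 ht, h'.1 hs, hw⟩) hd, hd⟩

theorem par_mono {A : Set α} {M M' N N' : Model α} (h : M ≤ M') (h' : N ≤ N') :
    par A M N ≤ par A M' N' :=
  generate_mono (fun _ ⟨s, t, hs, ht, hi⟩ => ⟨s, t, h.1 hs, h'.1 ht, hi⟩)
    (fun _ ⟨s, t, hs, ht, hi, hd⟩ =>
      ⟨s, t, h.1 hs, h'.1 ht, hi, hd.imp (fun hd => h.2 hd) (fun hd => h'.2 hd)⟩)

theorem hide_mono {A : Set α} {M M' : Model α} (h : M ≤ M') : hide M A ≤ hide M' A :=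
  generate_mono (fun _ ⟨t, ht, hw⟩ => ⟨t, h.1 ht, hw⟩)
    (Set.union_subset_union (fun _ ⟨t, ht, hw⟩ => ⟨t, h.2 ht, hw⟩)
      fun _ ⟨w, n, hA, hw, hv⟩ => ⟨w, n, hA, fun k => h.1 (hw k), hv⟩)

theorem rename_mono {R : α → α → Prop} {M M' : Model α} (h : M ≤ M') :
    rename M R ≤ rename M' R :=
  generate_mono (fun _ ⟨s, hs, hR⟩ => ⟨s, h.1 hs, hR⟩) (fun _ ⟨s, hs, hR⟩ => ⟨s, h.2 hs, hR⟩)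

end Model

/-! ### Denotational semantics -/

namespace Term

variable {α : Type u} {ν : Type v} [DecidableEq ν]

/-- The denotation of a term as a monotone function of the values of its variables. Recursion is
interpreted by the least fixed point with respect to reverse inclusion. -/
def denote : Term α ν → ((ν → Model α) →o Model α)
  | STOP => ⟨fun _ => Model.STOP, fun _ _ _ => le_rfl⟩
  | pre a P => ⟨fun ρ => Model.pre a (P.denote ρ),
      fun _ _ h => Model.pre_mono (P.denote.monotone h)⟩
  | SKIP => ⟨fun _ => Model.SKIP, fun _ _ _ => le_rfl⟩
  | intChoice P Q => ⟨fun ρ => Model.choice (P.denote ρ) (Q.denote ρ),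
      fun _ _ h => Model.choice_mono (P.denote.monotone h) (Q.denote.monotone h)⟩
  | extChoice P Q => ⟨fun ρ => Model.choice (P.denote ρ) (Q.denote ρ),
      fun _ _ h => Model.choice_mono (P.denote.monotone h) (Q.denote.monotone h)⟩
  | par A P Q => ⟨fun ρ => Model.par A (P.denote ρ) (Q.denote ρ),
      fun _ _ h => Model.par_mono (P.denote.monotone h) (Q.denote.monotone h)⟩
  | seq P Q => ⟨fun ρ => Model.seq (P.denote ρ) (Q.denote ρ),
      fun _ _ h => Model.seq_mono (P.denote.monotone h) (Q.denote.monotone h)⟩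
  | hide P A => ⟨fun ρ => Model.hide (P.denote ρ) A,
      fun _ _ h => Model.hide_mono (P.denote.monotone h)⟩
  | rename P R => ⟨fun ρ => Model.rename (P.denote ρ) R,
      fun _ _ h => Model.rename_mono (P.denote.monotone h)⟩
  | var X => ⟨fun ρ => ρ X, fun _ _ h => h X⟩
  | mu X P =>
      ⟨fun ρ => OrderHom.lfp ⟨fun x => P.denote (Function.update ρ X x),
          fun _ _ h => P.denote.monotone (update_le_update_iff.2 ⟨h, fun _ _ => le_rfl⟩)⟩,
        fun _ _ h => OrderHom.lfp.monotone fun _ =>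
          P.denote.monotone (update_le_update_iff.2 ⟨le_rfl, fun i _ => h i⟩)⟩
  | DIV => ⟨fun _ => Model.DIV, fun _ _ _ => le_rfl⟩

/-- A term is livelock-free if it has no divergences. The values `ρ` of the free variables are
irrelevant for a closed term. -/
def LivelockFree (P : Term α ν) : Prop := ∀ ρ : ν → Model α, (P.denote ρ).divs = ∅

end Term

/-! ### Static analysis -/

section Static

variable {α : Type u} {ν : Type v}

/-- The image of a set of events under a renaming relation. -/
def relImage (R : α → α → Prop) (U : Set α) : Set α := {y | ∃ x ∈ U, R x y}

open Classical in
/-- The nonexpansive sets of a term in the variable `X`. -/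
noncomputable def nonexpSets (X : ν) : Term α ν → Set (Set α × Set α)
  | .STOP => Set.univ
  | .pre a P => if X ∈ (Term.pre a P).freeVars then nonexpSets X P else Set.univ
  | .SKIP => Set.univ
  | .intChoice P Q =>
      if X ∈ (Term.intChoice P Q).freeVars then nonexpSets X P ∩ nonexpSets X Q else Set.univ
  | .extChoice P Q =>
      if X ∈ (Term.extChoice P Q).freeVars then nonexpSets X P ∩ nonexpSets X Q else Set.univ
  | .par A P Q =>
      if X ∈ (Term.par A P Q).freeVars then nonexpSets X P ∩ nonexpSets X Q else Set.univ
  | .seq P Q =>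
      if X ∈ (Term.seq P Q).freeVars then nonexpSets X P ∩ nonexpSets X Q else Set.univ
  | .hide P A =>
      if X ∈ (Term.hide P A).freeVars then
        {p | ∃ V', (p.1, V') ∈ nonexpSets X P ∧ V' ∩ A = ∅ ∧ V' ⊆ p.2}
      else Set.univ
  | .rename P R =>
      if X ∈ (Term.rename P R).freeVars then
        {p | ∃ V', (p.1, V') ∈ nonexpSets X P ∧ relImage R V' ⊆ p.2}
      else Set.univ
  | .var Y => if X ∈ (Term.var Y : Term α ν).freeVars then {p | p.1 ⊆ p.2} else Set.univ
  | .mu Y P =>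
      if X ∈ (Term.mu Y P).freeVars then
        {p | ∃ U' V', (U', V') ∈ nonexpSets X P ∧ (V', V') ∈ nonexpSets Y P ∧
          p.1 ⊆ U' ∧ V' ⊆ p.2}
      else Set.univ
  | .DIV => Set.univ

open Classical in
mutual

/-- The guard sets of a term. `DIV`, which can do anything, has none. -/
noncomputable def guardSets : Term α ν → Set (Set α)
  | .STOP => Set.univ
  | .pre a P => guardSets P ∪ {V | a ∈ V}
  | .SKIP => ∅
  | .intChoice P Q => guardSets P ∩ guardSets Q
  | .extChoice P Q => guardSets P ∩ guardSets Q
  | .par _ P Q =>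
      if (P.IsClosed ∧ fairSets P ≠ ∅) ∧ (Q.IsClosed ∧ fairSets Q ≠ ∅) then
        guardSets P ∪ guardSets Q
      else guardSets P ∩ guardSets Q
  | .seq P Q =>
      if P.IsClosed ∧ fairSets P ≠ ∅ then guardSets P ∪ guardSets Q else guardSets P
  | .hide P A =>
      if P.IsClosed ∧ (∅, Aᶜ) ∈ fairSets P then
        {V | ∃ V' ∈ guardSets P, V' ∩ A = ∅ ∧ V' ⊆ V}
      else ∅
  | .rename P R => {V | ∃ V' ∈ guardSets P, relImage R V' ⊆ V}
  | .var _ => ∅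
  | .mu _ P => guardSets P
  | .DIV => ∅

/-- The contractive sets of a term in the variable `X`. -/
noncomputable def contrSets (X : ν) : Term α ν → Set (Set α × Set α)
  | .STOP => Set.univ
  | .pre a P =>
      if X ∈ (Term.pre a P).freeVars then
        contrSets X P ∪ {p | p ∈ nonexpSets X P ∧ a ∈ p.2}
      else Set.univ
  | .SKIP => Set.univ
  | .intChoice P Q =>
      if X ∈ (Term.intChoice P Q).freeVars then contrSets X P ∩ contrSets X Q else Set.univ
  | .extChoice P Q =>
      if X ∈ (Term.extChoice P Q).freeVars then contrSets X P ∩ contrSets X Q else Set.univ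
  | .par A P Q =>
      if X ∈ (Term.par A P Q).freeVars then contrSets X P ∩ contrSets X Q else Set.univ
  | .seq P Q =>
      if X ∈ (Term.seq P Q).freeVars then
        contrSets X P ∩ (contrSets X Q ∪ {p | p ∈ nonexpSets X Q ∧ p.2 ∈ guardSets P})
      else Set.univ
  | .hide P A =>
      if X ∈ (Term.hide P A).freeVars then
        {p | ∃ V', (p.1, V') ∈ contrSets X P ∧ V' ∩ A = ∅ ∧ V' ⊆ p.2}
      else Set.univ
  | .rename P R =>
      if X ∈ (Term.rename P R).freeVars then
        {p | ∃ V', (p.1, V') ∈ contrSets X P ∧ relImage R V' ⊆ p.2}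
      else Set.univ
  | .var Y => if X ∈ (Term.var Y : Term α ν).freeVars then ∅ else Set.univ
  | .mu Y P =>
      if X ∈ (Term.mu Y P).freeVars then
        {p | ∃ U' V', (U', V') ∈ contrSets X P ∧ (V', V') ∈ nonexpSets Y P ∧
          p.1 ⊆ U' ∧ V' ⊆ p.2}
      else Set.univ
  | .DIV => Set.univ

/-- The (pairs of) fair sets of a term. `DIV` has none. -/
noncomputable def fairSets : Term α ν → Set (Set α × Set α)
  | .STOP => Set.univ
  | .pre _ P => fairSets P
  | .SKIP => Set.univ
  | .intChoice P Q => fairSets P ∩ fairSets Q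
  | .extChoice P Q => fairSets P ∩ fairSets Q
  | .par A P Q =>
      (fairSets P ∩ fairSets Q) ∪
      {p | ∃ U₁ U₂ V₁, (U₁, V₁) ∈ fairSets P ∧ (U₂, A) ∈ fairSets Q ∧ p = (U₁ ∩ U₂, V₁)} ∪
      {p | ∃ U₁ U₂ V₂, (U₂, V₂) ∈ fairSets Q ∧ (U₁, A) ∈ fairSets P ∧ p = (U₁ ∩ U₂, V₂)}
  | .seq P Q => fairSets P ∩ fairSets Q
  | .hide P A => {p | ∃ V', (p.1, V') ∈ fairSets P ∧ V' ∩ A = ∅ ∧ V' ⊆ p.2}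
  | .rename P R => {p | ∃ V', (p.1, V') ∈ fairSets P ∧ relImage R V' ⊆ p.2}
  | .var _ => {p | p.1 ⊆ p.2}
  | .mu X P =>
      if (Term.mu X P).IsClosed then
        {p | ∃ W, (W, W) ∈ contrSets X P ∩ fairSets P ∧ W ⊆ p.2}
      else {p | ∃ W, (W, W) ∈ contrSets X P ∩ fairSets P ∧ p.1 ⊆ W ∧ W ⊆ p.2}
  | .DIV => ∅

end

end Static

end CSP

-- Measure a trace by the number of its events in a set `V`. `RefinesUpTo V n M N` is a one-sided
-- approximation: `M` need only be contained in `N` on traces with fewer than `n` events of `V`.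
-- Each CSP operator transports this relation. `nonexpSets` records when passing from the value of
-- `X` to the value of `P` costs no level (`refinesUpTo_of_mem_nonexpSets`), and `contrSets` when a
-- level is gained (`refinesUpTo_of_mem_contrSets`). A level is gained from a prefix event in `V`,
-- or from a sequential composition whose first component cannot terminate properly without an event
-- of `V` (`Guarded`).
--
-- Fairness is taken in a uniform form: there is no divergence, and the length of a trace is bounded
-- by a function of its number of `V`-events. Finitely many such bounds combine explicitly under the
-- operators. An infinite run of hidden events would give arbitrarily long traces with boundedly
-- many `V`-events, so hiding events outside `V` creates no livelock.
--
-- For a recursion with contractive, fairness-preserving body `f` and fixed point `M`, the iterates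
-- of `f` from `STOP` are fair and the `n`-th one contains the part of `M` below level `n`. A
-- divergence has finitely many `V`-events and so lies below some level, which excludes it; the
-- length bounds transfer in the same way (`Fair.of_fixedPoint`). This uses only that `M` is a fixed
-- point. Leastness matters for the dependence of a recursion on its parameters (`RefinesUpTo.lfp`).
-- Induction on terms then gives `fair_of_mem_fairSets`, whose assumption on free variables is
-- vacuous for closed terms.

namespace CSP

universe u v

/-! ### Counting the events of a set -/

section Occ

variable {α : Type u}

open Classical in
/-- The number of events of the sequence `s` that belong to `V`. -/
noncomputable def occ (V : Set α) (s : List α) : ℕ := s.countP (fun a => a ∈ V)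

theorem occ_nil (V : Set α) : occ V [] = 0 := rfl

theorem occ_append (V : Set α) (s t : List α) : occ V (s ++ t) = occ V s + occ V t :=
  List.countP_append

theorem occ_cons_of_mem {V : Set α} {a : α} (h : a ∈ V) (s : List α) :
    occ V (a :: s) = occ V s + 1 := by
  simp [occ, h]

theorem occ_cons_of_notMem {V : Set α} {a : α} (h : a ∉ V) (s : List α) :
    occ V (a :: s) = occ V s := by
  simp [occ, h]

theorem occ_le_cons (V : Set α) (a : α) (s : List α) : occ V s ≤ occ V (a :: s) := by
  by_cases h : a ∈ V
  · simp [occ_cons_of_mem h]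
  · simp [occ_cons_of_notMem h]

theorem occ_cons_le (V : Set α) (a : α) (s : List α) : occ V (a :: s) ≤ occ V s + 1 := by
  by_cases h : a ∈ V
  · simp [occ_cons_of_mem h]
  · simp [occ_cons_of_notMem h]

theorem occ_cons_mono {V V' : Set α} {a b : α} {s t : List α} (hab : a ∈ V → b ∈ V')
    (h : occ V s ≤ occ V' t) : occ V (a :: s) ≤ occ V' (b :: t) := by
  by_cases ha : a ∈ V
  · rw [occ_cons_of_mem ha, occ_cons_of_mem (hab ha)]
    exact Nat.succ_le_succ h
  · rw [occ_cons_of_notMem ha]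
    exact h.trans (occ_le_cons _ _ _)

theorem occ_mono {V V' : Set α} (h : V ⊆ V') (s : List α) : occ V s ≤ occ V' s := by
  induction s with
  | nil => exact le_rfl
  | cons a s ih => exact occ_cons_mono (fun ha => h ha) ih

/-- Hiding deletes only events of `A`, so every event of `V'` survives. -/
theorem occ_hideList {V V' A : Set α} (hA : V' ∩ A = ∅) (hV : V' ⊆ V) (s : List α) :
    occ V' s ≤ occ V (hideList A s) := by
  induction s with
  | nil => exact le_rfl
  | cons a s ih =>
    by_cases ha : a ∈ A
    · have h' : a ∉ V' := fun h => (hA ▸ (⟨h, ha⟩ : a ∈ V' ∩ A) : a ∈ (∅ : Set α))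
      rw [occ_cons_of_notMem h']
      simpa [hideList, ha] using ih
    · have h' : hideList A (a :: s) = a :: hideList A s := by simp [hideList, ha]
      rw [h']
      exact occ_cons_mono (fun h => hV h) ih

theorem length_hideList_le (A : Set α) (s : List α) : (hideList A s).length ≤ s.length :=
  List.length_filter_le _ _

theorem occ_forall₂ {R : α → α → Prop} {V V' : Set α} (hR : relImage R V' ⊆ V)
    {s t : List α} (h : List.Forall₂ R s t) : occ V' s ≤ occ V t := by
  induction h with
  | nil => exact le_rfl
  | cons hab h ih => exact occ_cons_mono (fun ha => hR ⟨_, ha, hab⟩) ih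

theorem prefixOf_succ (w : ℕ → α) (k : ℕ) : prefixOf w (k + 1) = prefixOf w k ++ [w k] := by
  simp [prefixOf, List.range_succ]

theorem length_prefixOf (w : ℕ → α) (k : ℕ) : (prefixOf w k).length = k := by
  simp [prefixOf]

theorem occ_prefixOf_mono (V : Set α) (w : ℕ → α) : Monotone fun k => occ V (prefixOf w k) :=
  monotone_nat_of_le_succ fun k => by simp [prefixOf_succ, occ_append]

/-- For an infinite sequence whose tail is hidden: all its prefixes satisfy one common bound on the
events of a set disjoint from the hidden one. -/
theorem occ_prefixOf_le {V : Set α} {w : ℕ → α} {n : ℕ} (h : ∀ i, n ≤ i → w i ∉ V) (k : ℕ) :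
    occ V (prefixOf w k) ≤ occ V (prefixOf w n) := by
  induction k with
  | zero => exact occ_prefixOf_mono V w (Nat.zero_le n)
  | succ k ih =>
    by_cases hk : k < n
    · exact occ_prefixOf_mono V w hk
    · rw [prefixOf_succ, occ_append, occ_cons_of_notMem (h k (not_lt.1 hk)), occ_nil]
      exact ih

namespace Interleave

variable {A : Set α} {s t w : List α}

protected theorem comm (h : Interleave A s t w) : Interleave A t s w := by
  induction h with
  | nil => exact .nil
  | sync ha _ ih => exact .sync ha ih
  | left hb _ ih => exact .right hb ih
  | right hb _ ih => exact .left hb ih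

theorem occ_left_le (h : Interleave A s t w) (V : Set α) : occ V s ≤ occ V w := by
  induction h with
  | nil => exact le_rfl
  | sync _ _ ih => exact occ_cons_mono id ih
  | left _ _ ih => exact occ_cons_mono id ih
  | right _ _ ih => exact ih.trans (occ_le_cons _ _ _)

theorem occ_right_le (h : Interleave A s t w) (V : Set α) : occ V t ≤ occ V w :=
  h.comm.occ_left_le V

theorem length_le (h : Interleave A s t w) : w.length ≤ s.length + t.length := by
  induction h with
  | nil => exact le_rfl
  | sync _ _ ih => simp only [List.length_cons]; omega
  | left _ _ ih => simp only [List.length_cons]; omega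
  | right _ _ ih => simp only [List.length_cons]; omega

/-- The synchronised events of one component are performed by the other one as well. -/
theorem occ_right_le_length_left (h : Interleave A s t w) : occ A t ≤ s.length := by
  induction h with
  | nil => exact le_rfl
  | sync _ _ ih => exact (occ_cons_le _ _ _).trans (Nat.succ_le_succ ih)
  | left _ _ ih => exact ih.trans (Nat.le_succ _)
  | right hb _ ih => exact (occ_cons_of_notMem hb _).trans_le ih

end Interleave

end Occ

/-! ### Refinement on traces with few events of a set -/

namespace Model

variable {α : Type u}

/-- Every trace (divergence) of `M` with fewer than `n` events of `V` is one of `N`. -/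
def RefinesUpTo (V : Set α) (n : ℕ) (M N : Model α) : Prop :=
  ∀ t : Trace α, occ V t.evs < n →
    (t ∈ M.traces → t ∈ N.traces) ∧ (t ∈ M.divs → t ∈ N.divs)

namespace RefinesUpTo

variable {U V : Set α} {n : ℕ} {M M' N N' K : Model α}

protected theorem refl (V : Set α) (n : ℕ) (M : Model α) : RefinesUpTo V n M M :=
  fun _ _ => ⟨id, id⟩

protected theorem zero (V : Set α) (M N : Model α) : RefinesUpTo V 0 M N :=
  fun _ h => absurd h (Nat.not_lt_zero _)

protected theorem trans (h : RefinesUpTo V n M N) (h' : RefinesUpTo V n N K) :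
    RefinesUpTo V n M K :=
  fun t ht => ⟨fun hM => (h' t ht).1 ((h t ht).1 hM), fun hM => (h' t ht).2 ((h t ht).2 hM)⟩

/-- A larger set counts more events, so fewer traces fall below level `n`. -/
theorem mono_set (hUV : U ⊆ V) (h : RefinesUpTo U n M N) : RefinesUpTo V n M N :=
  fun t ht => h t ((occ_mono hUV _).trans_lt ht)

theorem traces (h : RefinesUpTo V n M N) {s : List α} {b : Bool} (hs : occ V s < n)
    (hM : ⟨s, b⟩ ∈ M.traces) : ⟨s, b⟩ ∈ N.traces :=
  (h ⟨s, b⟩ hs).1 hM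

theorem divs (h : RefinesUpTo V n M N) {s : List α} {b : Bool} (hs : occ V s < n)
    (hM : ⟨s, b⟩ ∈ M.divs) : ⟨s, b⟩ ∈ N.divs :=
  (h ⟨s, b⟩ hs).2 hM

/-- A divergence extends a generating sequence, which has no more events of `V` and therefore lies
below the same level. -/
theorem generate {T₀ T₁ : Set (Trace α)} {D₀ D₁ : Set (List α)} {h₁ h₂ h₃ h₄ h₅ h₆}
    (hT : ∀ t ∈ T₀, occ V t.evs < n → t ∈ T₁) (hD : ∀ s ∈ D₀, occ V s < n → s ∈ D₁) :
    RefinesUpTo V n (generate T₀ D₀ h₁ h₂ h₃) (Model.generate T₁ D₁ h₄ h₅ h₆) := by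
  intro t ht
  have h : (∃ s ∈ D₀, ∃ r, t = Trace.cat s r) → ∃ s ∈ D₁, ∃ r, t = Trace.cat s r := by
    rintro ⟨s, hs, r, rfl⟩
    refine ⟨s, hD s hs (lt_of_le_of_lt ?_ ht), r, rfl⟩
    simp [Trace.cat, occ_append]
  exact ⟨fun h' => h'.imp (fun h' => hT t h' ht) h, h⟩

theorem pre (a : α) (h : RefinesUpTo V n M N) : RefinesUpTo V n (pre a M) (Model.pre a N) := by
  have key : ∀ t : Trace α, occ V (Trace.cat [a] t).evs < n → occ V t.evs < n :=
    fun t ht => (occ_le_cons V a t.evs).trans_lt ht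
  refine fun w hw => ⟨fun h' => h'.imp id ?_, ?_⟩
  · rintro ⟨t, ht, rfl⟩
    exact ⟨t, (h t (key t hw)).1 ht, rfl⟩
  · rintro ⟨t, ht, rfl⟩
    exact ⟨t, (h t (key t hw)).2 ht, rfl⟩

/-- The leading `a` already counts as one event of `V`; this is the basic source of contraction. -/
theorem pre_succ {a : α} (ha : a ∈ V) (h : RefinesUpTo V n M N) :
    RefinesUpTo V (n + 1) (Model.pre a M) (Model.pre a N) := by
  have key : ∀ t : Trace α, occ V (Trace.cat [a] t).evs < n + 1 → occ V t.evs < n :=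
    fun t ht => Nat.lt_of_succ_lt_succ ((occ_cons_of_mem ha t.evs).symm.trans_lt ht)
  refine fun w hw => ⟨fun h' => h'.imp id ?_, ?_⟩
  · rintro ⟨t, ht, rfl⟩
    exact ⟨t, (h t (key t hw)).1 ht, rfl⟩
  · rintro ⟨t, ht, rfl⟩
    exact ⟨t, (h t (key t hw)).2 ht, rfl⟩

theorem choice (h : RefinesUpTo V n M M') (h' : RefinesUpTo V n N N') :
    RefinesUpTo V n (choice M N) (Model.choice M' N') :=
  fun t ht => ⟨Or.imp (h t ht).1 (h' t ht).1, Or.imp (h t ht).2 (h' t ht).2⟩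

/-- Sequential composition, given that the traces of the second component that matter have fewer
than `k` events of `V`. -/
theorem seq_of_occ {k : ℕ} (h : RefinesUpTo V n M M') (h' : RefinesUpTo V k N N')
    (hk : ∀ t s, ⟨t, true⟩ ∈ M.traces → occ V t + occ V s < n →
      ⟨t, false⟩ ∈ M.divs ∨ occ V s < k) :
    RefinesUpTo V n (seq M N) (Model.seq M' N') := by
  have key : ∀ (t : List α) (s : Trace α), ⟨t, true⟩ ∈ M.traces →
      occ V (Trace.cat t s).evs < n →
      Trace.cat t s ∈ M'.divs ∨ (⟨t, true⟩ ∈ M'.traces ∧ occ V s.evs < k) := by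
    intro t s ht hts
    have hts' : occ V t + occ V s.evs < n := (occ_append V t s.evs).symm.trans_lt hts
    -- If `t` diverges in `M`, so does its extension by `s`, and the hypothesis on `M` alone
    -- transfers it; only otherwise is the second component compared.
    refine (hk t s.evs ht hts').imp (fun hd => ?_) (fun hs => ⟨?_, hs⟩)
    · exact (h _ hts).2 (M.divs_extend t hd s)
    · exact h.traces (by omega) ht
  have hd : ∀ w : Trace α, occ V w.evs < n → w ∈ (Model.seq M N).divs →
      w ∈ (Model.seq M' N').divs := by
    rintro w hw (hM | ⟨t, s, ht, hs, rfl⟩)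
    · exact .inl ((h w hw).2 hM)
    · exact (key t s ht hw).imp id fun ⟨h1, h2⟩ => ⟨t, s, h1, (h' s h2).2 hs, rfl⟩
  refine fun w hw => ⟨?_, hd w hw⟩
  rintro ((⟨hM, hb⟩ | ⟨t, s, ht, hs, rfl⟩) | hwd)
  · exact .inl (.inl ⟨(h w hw).1 hM, hb⟩)
  · rcases key t s ht hw with h1 | ⟨h1, h2⟩
    · exact .inr (.inl h1)
    · exact .inl (.inr ⟨t, s, h1, (h' s h2).1 hs, rfl⟩)
  · exact .inr (hd w hw hwd)

theorem seq (h : RefinesUpTo V n M M') (h' : RefinesUpTo V n N N') :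
    RefinesUpTo V n (seq M N) (Model.seq M' N') :=
  h.seq_of_occ h' fun _ _ _ hts => .inr (by omega)

theorem par (A : Set α) (h : RefinesUpTo V n M M') (h' : RefinesUpTo V n N N') :
    RefinesUpTo V n (par A M N) (Model.par A M' N') := by
  refine generate ?_ ?_
  · rintro w ⟨s, t, hs, ht, hi⟩ hw
    exact ⟨s, t, h.traces ((hi.occ_left_le V).trans_lt hw) hs,
      h'.traces ((hi.occ_right_le V).trans_lt hw) ht, hi⟩
  · rintro w ⟨s, t, hs, ht, hi, hd⟩ hw
    have h1 := (hi.occ_left_le V).trans_lt hw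
    have h2 := (hi.occ_right_le V).trans_lt hw
    exact ⟨s, t, h.traces h1 hs, h'.traces h2 ht, hi, hd.imp (h.divs h1) (h'.divs h2)⟩

theorem hide {A : Set α} (hA : U ∩ A = ∅) (hUV : U ⊆ V) (h : RefinesUpTo U n M N) :
    RefinesUpTo V n (hide M A) (Model.hide N A) := by
  have key : ∀ {s}, occ V (hideList A s) < n → occ U s < n :=
    fun hs => (occ_hideList hA hUV _).trans_lt hs
  refine generate ?_ ?_
  · rintro w ⟨t, ht, he⟩ hw
    rw [he] at hw
    exact ⟨t, h.traces (key hw) ht, he⟩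
  · rintro v (⟨t, ht, rfl⟩ | ⟨w, m, hm, hw, rfl⟩) hv
    · exact .inl ⟨t, h.divs (key hv) ht, rfl⟩
    -- The hidden tail contributes no event of `U`, so all prefixes of `w` lie below level `n`
    -- together and the whole infinite sequence passes to `N`.
    · have hU : ∀ i, m ≤ i → w i ∉ U := fun i hi hwi =>
        (hA ▸ (⟨hwi, hm i hi⟩ : w i ∈ U ∩ A) : w i ∈ (∅ : Set α))
      exact .inr ⟨w, m, hm, fun k => h.traces ((occ_prefixOf_le hU k).trans_lt (key hv)) (hw k),
        rfl⟩

theorem rename {R : α → α → Prop} (hR : relImage R U ⊆ V) (h : RefinesUpTo U n M N) :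
    RefinesUpTo V n (rename M R) (Model.rename N R) := by
  refine generate ?_ ?_
  · rintro w ⟨s, hs, hi⟩ hw
    exact ⟨s, h.traces ((occ_forall₂ hR hi).trans_lt hw) hs, hi⟩
  · rintro w ⟨s, hs, hi⟩ hw
    exact ⟨s, h.divs ((occ_forall₂ hR hi).trans_lt hw) hs, hi⟩

/-- Suprema in the model are intersections, so the relation can be checked pair by pair. This
closure property is what allows fixed-point induction. -/
theorem sSup {S : Set (Model α × Model α)} (h : ∀ p ∈ S, RefinesUpTo V n p.1 p.2) :
    RefinesUpTo V n (sSup S).1 (SupSet.sSup S).2 := by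
  intro t ht
  rw [Prod.fst_sSup, Prod.snd_sSup]
  constructor
  · intro hM
    refine Set.mem_iInter₂.2 ?_
    rintro _ ⟨p, hp, rfl⟩
    exact (h p hp t ht).1 (Set.mem_iInter₂.1 hM p.1 ⟨p, hp, rfl⟩)
  · intro hM
    refine Set.mem_iInter₂.2 ?_
    rintro _ ⟨p, hp, rfl⟩
    exact (h p hp t ht).2 (Set.mem_iInter₂.1 hM p.1 ⟨p, hp, rfl⟩)

/-- The least fixed points of two maps are related if the maps preserve the relation. -/
theorem lfp {f g : Model α →o Model α}
    (h : ∀ x y, RefinesUpTo V n x y → RefinesUpTo V n (f x) (g y)) :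
    RefinesUpTo V n (OrderHom.lfp f) (OrderHom.lfp g) := by
  -- Both fixed points are computed at once: the least fixed point of the product map is the pair of
  -- least fixed points, so a single induction handles the relation between them.
  let F : Model α × Model α →o Model α × Model α :=
    ⟨fun p => (f p.1, g p.2), fun _ _ hpq => ⟨f.monotone hpq.1, g.monotone hpq.2⟩⟩
  have hF : OrderHom.lfp F = (OrderHom.lfp f, OrderHom.lfp g) := by
    have hfix : F (OrderHom.lfp F) = OrderHom.lfp F := OrderHom.map_lfp F
    refine le_antisymm (OrderHom.lfp_le F ?_) ⟨?_, ?_⟩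
    · exact ⟨(OrderHom.map_lfp f).le, (OrderHom.map_lfp g).le⟩
    · exact OrderHom.lfp_le f (congrArg Prod.fst hfix).le
    · exact OrderHom.lfp_le g (congrArg Prod.snd hfix).le
  have := OrderHom.lfp_induction F (p := fun p => RefinesUpTo V n p.1 p.2)
    (fun p hp _ => h p.1 p.2 hp) (fun S hS => sSup hS)
  rwa [hF] at this

end RefinesUpTo

/-! ### Guarded termination -/

/-- Every sequence of events after which `M` may terminate contains an event of `V`, unless it is
a divergence. -/
def Guarded (V : Set α) (M : Model α) : Prop :=
  ∀ s : List α, ⟨s, true⟩ ∈ M.traces → ⟨s, false⟩ ∈ M.divs ∨ 0 < occ V s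

namespace Guarded

variable {V V' : Set α} {M N : Model α}

theorem generate {T₀ : Set (Trace α)} {D₀ : Set (List α)} {h₁ h₂ h₃}
    (h : ∀ s, ⟨s, true⟩ ∈ T₀ → s ∈ D₀ ∨ 0 < occ V s) :
    Guarded V (generate T₀ D₀ h₁ h₂ h₃) := by
  rintro s (hs | hs)
  · exact (h s hs).imp (fun hd => ⟨s, hd, .nil, by simp [Trace.cat, Trace.nil]⟩) id
  · exact .inl ((Model.generate T₀ D₀ h₁ h₂ h₃).divs_of_tick s hs)

theorem deadlock (V : Set α) : Guarded V STOP := by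
  intro s hs
  cases hs

theorem pre_of_mem {a : α} (ha : a ∈ V) (M : Model α) : Guarded V (Model.pre a M) := by
  rintro s (hs | ⟨t, ht, hs⟩)
  · cases hs
  · obtain rfl : s = [a] ++ t.evs := congrArg Trace.evs hs
    exact .inr (by simp [occ_cons_of_mem ha])

theorem pre (a : α) (h : Guarded V M) : Guarded V (Model.pre a M) := by
  rintro s (hs | ⟨⟨t, b⟩, ht, hs⟩)
  · cases hs
  · obtain ⟨rfl, rfl⟩ : s = [a] ++ t ∧ true = b := by simpa [Trace.cat] using hs
    exact (h t ht).imp (fun hd => ⟨⟨t, false⟩, hd, rfl⟩) fun h0 => h0.trans_le (occ_le_cons _ _ _)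

theorem choice (h : Guarded V M) (h' : Guarded V N) : Guarded V (choice M N) := by
  rintro s (hs | hs)
  · exact (h s hs).imp .inl id
  · exact (h' s hs).imp .inr id

theorem seq (h : Guarded V M ∨ Guarded V N) : Guarded V (seq M N) := by
  rintro w ((⟨-, hw⟩ | ⟨t, ⟨s, b⟩, ht, hs, hw⟩) | hw)
  · cases hw
  · obtain ⟨rfl, rfl⟩ : w = t ++ s ∧ true = b := by simpa [Trace.cat] using hw
    rw [occ_append]
    rcases h with h | h
    · exact (h t ht).imp (fun hd => .inl (M.divs_extend t hd ⟨s, false⟩)) fun h0 => by omega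
    · exact (h s hs).imp (fun hd => .inr ⟨t, ⟨s, false⟩, ht, hd, rfl⟩) fun h0 => by omega
  · exact .inl ((Model.seq M N).divs_of_tick w hw)

/-- Termination is joint, so both components have a terminating trace and a guard in either one
suffices. -/
theorem par (A : Set α) (h : Guarded V M ∨ Guarded V N) : Guarded V (par A M N) := by
  refine generate ?_
  rintro w ⟨s, t, hs, ht, hi⟩
  -- Divergences of a parallel composition are generated by traces without termination, so the final
  -- event is dropped from both components.
  have hs' := M.prefix_closed ⟨s, false⟩ _ hs (.inr ⟨rfl, List.prefix_rfl⟩)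
  have ht' := N.prefix_closed ⟨t, false⟩ _ ht (.inr ⟨rfl, List.prefix_rfl⟩)
  rcases h with h | h
  · exact (h s hs).imp (fun hd => ⟨s, t, hs', ht', hi, .inl hd⟩)
      fun h0 => h0.trans_le (hi.occ_left_le V)
  · exact (h t ht).imp (fun hd => ⟨s, t, hs', ht', hi, .inr hd⟩)
      fun h0 => h0.trans_le (hi.occ_right_le V)

theorem hide {A : Set α} (hA : V' ∩ A = ∅) (hV : V' ⊆ V) (h : Guarded V' M) :
    Guarded V (hide M A) := by
  refine generate ?_
  rintro w ⟨t, ht, he⟩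
  obtain rfl : w = hideList A t := he
  exact (h t ht).imp (fun hd => .inl ⟨t, hd, rfl⟩) fun h0 => h0.trans_le (occ_hideList hA hV t)

theorem rename {R : α → α → Prop} (hR : relImage R V' ⊆ V) (h : Guarded V' M) :
    Guarded V (rename M R) := by
  refine generate ?_
  rintro w ⟨s, hs, hi⟩
  exact (h s hs).imp (fun hd => ⟨s, hd, hi⟩) fun h0 => h0.trans_le (occ_forall₂ hR hi)

end Guarded

/-- Unless the first component diverges, it uses up at least one event of `V` before control passes
on, so level `n` is enough for the second. -/
theorem RefinesUpTo.seq_of_guarded {V : Set α} {n : ℕ} {M M' N N' : Model α} (hM : Guarded V M)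
    (h : RefinesUpTo V (n + 1) M M') (h' : RefinesUpTo V n N N') :
    RefinesUpTo V (n + 1) (Model.seq M N) (Model.seq M' N') :=
  h.seq_of_occ h' fun t _ ht _ => (hM t ht).imp id fun h0 => by omega

/-! ### Fairness -/

/-- `M` has no divergence, and the length of its traces is bounded in terms of the number of
their events in `V`; hence every infinite trace of `M` has infinitely many events in `V`. -/
def Fair (V : Set α) (M : Model α) : Prop :=
  M.divs = ∅ ∧ ∀ n : ℕ, ∃ B : ℕ, ∀ t ∈ M.traces, occ V t.evs ≤ n → t.evs.length ≤ B

namespace Fair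

variable {U V V' : Set α} {M N : Model α}

theorem mono (hUV : U ⊆ V) (h : Fair U M) : Fair V M := by
  refine ⟨h.1, fun n => ?_⟩
  obtain ⟨B, hB⟩ := h.2 n
  exact ⟨B, fun t ht hn => hB t ht ((occ_mono hUV _).trans hn)⟩

theorem notMem_divs (h : Fair V M) (t : Trace α) : t ∉ M.divs := by
  rw [h.1]
  exact Set.notMem_empty t

theorem generate {T₀ : Set (Trace α)} {D₀ : Set (List α)} {h₁ h₂ h₃} (hD : ∀ s, s ∉ D₀)
    (hT : ∀ n : ℕ, ∃ B : ℕ, ∀ t ∈ T₀, occ V t.evs ≤ n → t.evs.length ≤ B) :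
    Fair V (generate T₀ D₀ h₁ h₂ h₃) := by
  have hd : (Model.generate T₀ D₀ h₁ h₂ h₃).divs = ∅ :=
    Set.eq_empty_of_forall_notMem fun _ ⟨s, hs, _⟩ => hD s hs
  refine ⟨hd, fun n => ?_⟩
  obtain ⟨B, hB⟩ := hT n
  refine ⟨B, ?_⟩
  rintro t (ht | ⟨s, hs, -⟩)
  · exact hB t ht
  · exact absurd hs (hD s)

theorem deadlock (V : Set α) : Fair V STOP := by
  refine ⟨rfl, fun n => ⟨0, ?_⟩⟩
  rintro t rfl -
  exact le_rfl

theorem skip (V : Set α) : Fair V SKIP := by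
  refine ⟨rfl, fun n => ⟨0, ?_⟩⟩
  rintro t (rfl | rfl) - <;> exact le_rfl

theorem pre (a : α) (h : Fair V M) : Fair V (pre a M) := by
  refine ⟨Set.eq_empty_of_forall_notMem fun _ ⟨t, ht, _⟩ => h.notMem_divs t ht, fun n => ?_⟩
  obtain ⟨B, hB⟩ := h.2 n
  refine ⟨B + 1, ?_⟩
  rintro w (rfl | ⟨t, ht, rfl⟩) hn
  · exact Nat.zero_le _
  · exact Nat.succ_le_succ (hB t ht ((occ_le_cons V a t.evs).trans hn))

theorem choice (h : Fair V M) (h' : Fair V N) : Fair V (choice M N) := by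
  refine ⟨Set.eq_empty_of_forall_notMem fun t ht =>
    ht.elim (h.notMem_divs t) (h'.notMem_divs t), fun n => ?_⟩
  obtain ⟨B, hB⟩ := h.2 n
  obtain ⟨C, hC⟩ := h'.2 n
  refine ⟨max B C, ?_⟩
  rintro t (ht | ht) hn
  · exact le_max_of_le_left (hB t ht hn)
  · exact le_max_of_le_right (hC t ht hn)

theorem seq (h : Fair V M) (h' : Fair V N) : Fair V (seq M N) := by
  have hd : ∀ w, w ∉ (Model.seq M N).divs := by
    rintro w (hw | ⟨-, s, -, hs, -⟩)
    · exact h.notMem_divs w hw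
    · exact h'.notMem_divs s hs
  refine ⟨Set.eq_empty_of_forall_notMem hd, fun n => ?_⟩
  obtain ⟨B, hB⟩ := h.2 n
  obtain ⟨C, hC⟩ := h'.2 n
  refine ⟨B + C, ?_⟩
  rintro w ((⟨hw, -⟩ | ⟨t, s, ht, hs, rfl⟩) | hw) hn
  · exact (hB w hw hn).trans (Nat.le_add_right _ _)
  · have hn' : occ V t + occ V s.evs ≤ n := (occ_append V t s.evs).symm.trans_le hn
    have h1 : t.length ≤ B := hB _ ht ((Nat.le_add_right _ _).trans hn')
    have h2 := hC s hs ((Nat.le_add_left _ _).trans hn')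
    simpa [Trace.cat] using add_le_add h1 h2
  · exact absurd hw (hd w)

theorem notMem_par_divs (h : Fair U M) (h' : Fair V N) {s t : List α} :
    ¬(⟨s, false⟩ ∈ M.divs ∨ ⟨t, false⟩ ∈ N.divs) :=
  fun hd => hd.elim (h.notMem_divs _) (h'.notMem_divs _)

theorem par (A : Set α) (h : Fair V M) (h' : Fair V N) : Fair V (par A M N) := by
  refine generate (fun w ⟨s, t, _, _, _, hd⟩ => h.notMem_par_divs h' hd) fun n => ?_
  obtain ⟨B, hB⟩ := h.2 n
  obtain ⟨C, hC⟩ := h'.2 n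
  refine ⟨B + C, ?_⟩
  rintro w ⟨s, t, hs, ht, hi⟩ hn
  exact hi.length_le.trans (add_le_add (hB _ hs ((hi.occ_left_le V).trans hn))
    (hC _ ht ((hi.occ_right_le V).trans hn)))

/-- If one component performs infinitely many synchronised events, then fairness of the other one
is inherited by the parallel composition. -/
theorem par_of_sync_right {A : Set α} (h : Fair V M) (h' : Fair A N) :
    Fair V (Model.par A M N) := by
  refine generate (fun w ⟨s, t, _, _, _, hd⟩ => h.notMem_par_divs h' hd) fun n => ?_
  obtain ⟨B, hB⟩ := h.2 n
  -- Traces of `M` have length at most `B`, so `N` takes part in at most `B` synchronised events;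
  -- fairness of `N` for `A` is applied with that number.
  obtain ⟨C, hC⟩ := h'.2 B
  refine ⟨B + C, ?_⟩
  rintro w ⟨s, t, hs, ht, hi⟩ hn
  have h1 : s.length ≤ B := hB _ hs ((hi.occ_left_le V).trans hn)
  exact hi.length_le.trans (add_le_add h1 (hC _ ht (hi.occ_right_le_length_left.trans h1)))

theorem par_of_sync_left {A : Set α} (h : Fair A M) (h' : Fair V N) :
    Fair V (Model.par A M N) := by
  refine generate (fun w ⟨s, t, _, _, _, hd⟩ => h.notMem_par_divs h' hd) fun n => ?_
  obtain ⟨C, hC⟩ := h'.2 n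
  obtain ⟨B, hB⟩ := h.2 C
  refine ⟨B + C, ?_⟩
  rintro w ⟨s, t, hs, ht, hi⟩ hn
  have h1 : t.length ≤ C := hC _ ht ((hi.occ_right_le V).trans hn)
  exact hi.length_le.trans
    (add_le_add (hB _ hs (hi.comm.occ_right_le_length_left.trans h1)) h1)

theorem hide {A : Set α} (hA : V' ∩ A = ∅) (hV : V' ⊆ V) (h : Fair V' M) :
    Fair V (hide M A) := by
  refine generate ?_ fun n => ?_
  · rintro v (⟨t, ht, -⟩ | ⟨w, m, hm, hw, -⟩)
    · exact h.notMem_divs _ ht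
    · have hV' : ∀ i, m ≤ i → w i ∉ V' := fun i hi hwi =>
        (hA ▸ (⟨hwi, hm i hi⟩ : w i ∈ V' ∩ A) : w i ∈ (∅ : Set α))
      obtain ⟨B, hB⟩ := h.2 (occ V' (prefixOf w m))
      -- The prefix of length `B + 1` has no more events of `V'` than the one of length `m`, against
      -- the length bound `B`.
      have := hB _ (hw (B + 1)) (occ_prefixOf_le hV' _)
      rw [length_prefixOf] at this
      omega
  · obtain ⟨B, hB⟩ := h.2 n
    refine ⟨B, ?_⟩
    rintro w ⟨t, ht, he⟩ hn
    rw [he] at hn ⊢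
    exact (length_hideList_le A t).trans (hB _ ht ((occ_hideList hA hV t).trans hn))

theorem rename {R : α → α → Prop} (hR : relImage R V' ⊆ V) (h : Fair V' M) :
    Fair V (rename M R) := by
  refine generate (fun w ⟨s, hs, _⟩ => h.notMem_divs _ hs) fun n => ?_
  obtain ⟨B, hB⟩ := h.2 n
  refine ⟨B, ?_⟩
  rintro w ⟨s, hs, hi⟩ hn
  rw [← hi.length_eq]
  exact hB _ hs ((occ_forall₂ hR hi).trans hn)

/-- Each instance of fairness concerns traces below one finite level, so a different fair
approximant may be used for each. The level is one above the count because refinement is tested on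
strictly fewer events. -/
theorem of_refinesUpTo (h : ∀ n, ∃ N, Fair V N ∧ RefinesUpTo V n M N) : Fair V M := by
  constructor
  · refine Set.eq_empty_of_forall_notMem fun t ht => ?_
    obtain ⟨N, hN, hMN⟩ := h (occ V t.evs + 1)
    exact hN.notMem_divs t ((hMN t (Nat.lt_succ_self _)).2 ht)
  · intro n
    obtain ⟨N, hN, hMN⟩ := h (n + 1)
    obtain ⟨B, hB⟩ := hN.2 n
    exact ⟨B, fun t ht hn => hB t ((hMN t (Nat.lt_succ_of_le hn)).1 ht) hn⟩

/-- Every fixed point of a contractive map that preserves fairness is fair. -/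
theorem of_fixedPoint {f : Model α → Model α} (hM : f M = M)
    (hf : ∀ x, Fair V x → Fair V (f x))
    (hc : ∀ n x y, RefinesUpTo V n x y → RefinesUpTo V (n + 1) (f x) (f y)) : Fair V M := by
  refine of_refinesUpTo fun n => ?_
  induction n with
  -- No trace lies below level `0`, so any fair process could start the iteration.
  | zero => exact ⟨STOP, deadlock V, .zero V M STOP⟩
  | succ n ih =>
    obtain ⟨N, hN, hMN⟩ := ih
    refine ⟨f N, hf N hN, ?_⟩
    have := hc n M N hMN
    rwa [hM] at this

end Fair

end Model

/-! ### Soundness of the static analysis -/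

namespace Term

variable {α : Type u} {ν : Type v} [DecidableEq ν]

theorem denote_mu (X : ν) (P : Term α ν) (ρ : ν → Model α) :
    P.denote (Function.update ρ X ((mu X P).denote ρ)) = (mu X P).denote ρ :=
  OrderHom.map_lfp (⟨fun x => P.denote (Function.update ρ X x),
    fun _ _ h => P.denote.monotone (update_le_update_iff.2 ⟨h, fun _ _ => le_rfl⟩)⟩ :
      Model α →o Model α)

/-- The denotation depends on the values of the free variables only. -/
theorem denote_congr (P : Term α ν) {ρ ρ' : ν → Model α} (h : ∀ X ∈ P.freeVars, ρ X = ρ' X) :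
    P.denote ρ = P.denote ρ' := by
  induction P generalizing ρ ρ' with
  | STOP => rfl
  | SKIP => rfl
  | DIV => rfl
  | pre a P ih => exact congrArg (Model.pre a) (ih h)
  | intChoice P Q ihP ihQ =>
    exact congrArg₂ Model.choice (ihP fun X hX => h X (.inl hX)) (ihQ fun X hX => h X (.inr hX))
  | extChoice P Q ihP ihQ =>
    exact congrArg₂ Model.choice (ihP fun X hX => h X (.inl hX)) (ihQ fun X hX => h X (.inr hX))
  | par A P Q ihP ihQ =>
    exact congrArg₂ (Model.par A) (ihP fun X hX => h X (.inl hX)) (ihQ fun X hX => h X (.inr hX))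
  | seq P Q ihP ihQ =>
    exact congrArg₂ Model.seq (ihP fun X hX => h X (.inl hX)) (ihQ fun X hX => h X (.inr hX))
  | hide P A ih => exact congrArg (Model.hide · A) (ih h)
  | rename P R ih => exact congrArg (Model.rename · R) (ih h)
  | var X => exact h X rfl
  | mu Y P ih =>
    refine congrArg OrderHom.lfp (OrderHom.ext _ _ (funext fun x => ih fun X hX => ?_))
    by_cases hXY : X = Y
    · subst hXY
      simp
    · simpa [hXY] using h X ⟨hX, hXY⟩

theorem denote_update_of_notMem {P : Term α ν} {X : ν} (hX : X ∉ P.freeVars) (ρ : ν → Model α)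
    (x y : Model α) :
    P.denote (Function.update ρ X x) = P.denote (Function.update ρ X y) := by
  refine denote_congr P fun Y hY => ?_
  have : Y ≠ X := fun h => hX (h ▸ hY)
  simp [this]

open Model

/-- Justifies the convention that every pair is nonexpansive and contractive when the variable is
not free. -/
theorem refinesUpTo_of_notMem {P : Term α ν} {X : ν} (hX : X ∉ P.freeVars) (ρ : ν → Model α)
    (x y : Model α) (V : Set α) (n : ℕ) :
    RefinesUpTo V n (P.denote (Function.update ρ X x)) (P.denote (Function.update ρ X y)) := by
  rw [denote_update_of_notMem hX ρ x y]
  exact .refl _ _ _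

/-- Recursion preserves refinement in a parameter `X` if the body is nonexpansive in the variable
of the recursion. -/
theorem refinesUpTo_mu {P : Term α ν} {X Y : ν} (hXY : X ≠ Y) {V : Set α} {n : ℕ} {x y : Model α}
    (ρ : ν → Model α)
    (hX : ∀ ρ : ν → Model α, RefinesUpTo V n (P.denote (Function.update ρ X x))
      (P.denote (Function.update ρ X y)))
    (hY : ∀ (ρ : ν → Model α) (z z' : Model α), RefinesUpTo V n z z' →
      RefinesUpTo V n (P.denote (Function.update ρ Y z)) (P.denote (Function.update ρ Y z'))) :
    RefinesUpTo V n ((mu Y P).denote (Function.update ρ X x))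
      ((mu Y P).denote (Function.update ρ X y)) := by
  refine RefinesUpTo.lfp fun z z' hz => ?_
  -- The parameter `X` is changed first and the recursion variable `Y` second, so each hypothesis is
  -- used for one variable at a time.
  refine RefinesUpTo.trans (N := P.denote (Function.update (Function.update ρ X y) Y z)) ?_
    (hY _ z z' hz)
  have := hX (Function.update ρ Y z)
  rwa [Function.update_comm hXY.symm, Function.update_comm hXY.symm] at this

theorem refinesUpTo_of_mem_nonexpSets (P : Term α ν) {X : ν} {U V : Set α}
    (h : (U, V) ∈ nonexpSets X P) (ρ : ν → Model α) {n : ℕ} {x y : Model α}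
    (hxy : RefinesUpTo U n x y) :
    RefinesUpTo V n (P.denote (Function.update ρ X x)) (P.denote (Function.update ρ X y)) := by
  -- The variable is generalized because a recursion needs the induction hypothesis for its bound
  -- variable as well as for `X`.
  induction P generalizing X U V ρ n x y with
  | STOP => exact .refl _ _ _
  | SKIP => exact .refl _ _ _
  | DIV => exact .refl _ _ _
  | pre a P ih =>
    by_cases hX : X ∈ (Term.pre a P).freeVars
    · rw [nonexpSets, if_pos hX] at h
      exact .pre a (ih h ρ hxy)
    · exact refinesUpTo_of_notMem hX ρ x y V n
  | intChoice P Q ihP ihQ =>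
    by_cases hX : X ∈ (Term.intChoice P Q).freeVars
    · rw [nonexpSets, if_pos hX] at h
      exact .choice (ihP h.1 ρ hxy) (ihQ h.2 ρ hxy)
    · exact refinesUpTo_of_notMem hX ρ x y V n
  | extChoice P Q ihP ihQ =>
    by_cases hX : X ∈ (Term.extChoice P Q).freeVars
    · rw [nonexpSets, if_pos hX] at h
      exact .choice (ihP h.1 ρ hxy) (ihQ h.2 ρ hxy)
    · exact refinesUpTo_of_notMem hX ρ x y V n
  | par A P Q ihP ihQ =>
    by_cases hX : X ∈ (Term.par A P Q).freeVars
    · rw [nonexpSets, if_pos hX] at h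
      exact .par A (ihP h.1 ρ hxy) (ihQ h.2 ρ hxy)
    · exact refinesUpTo_of_notMem hX ρ x y V n
  | seq P Q ihP ihQ =>
    by_cases hX : X ∈ (Term.seq P Q).freeVars
    · rw [nonexpSets, if_pos hX] at h
      exact .seq (ihP h.1 ρ hxy) (ihQ h.2 ρ hxy)
    · exact refinesUpTo_of_notMem hX ρ x y V n
  | hide P A ih =>
    by_cases hX : X ∈ (Term.hide P A).freeVars
    · rw [nonexpSets, if_pos hX] at h
      obtain ⟨V', hV', hA, hV⟩ := h
      exact .hide hA hV (ih hV' ρ hxy)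
    · exact refinesUpTo_of_notMem hX ρ x y V n
  | rename P R ih =>
    by_cases hX : X ∈ (Term.rename P R).freeVars
    · rw [nonexpSets, if_pos hX] at h
      obtain ⟨V', hV', hR⟩ := h
      exact .rename hR (ih hV' ρ hxy)
    · exact refinesUpTo_of_notMem hX ρ x y V n
  | var Y =>
    by_cases hX : X ∈ (Term.var Y : Term α ν).freeVars
    · rw [nonexpSets, if_pos hX] at h
      obtain rfl : X = Y := hX
      change RefinesUpTo V n (Function.update ρ X x X) (Function.update ρ X y X)
      simpa using hxy.mono_set h
    · exact refinesUpTo_of_notMem hX ρ x y V n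
  | mu Y P ih =>
    by_cases hX : X ∈ (Term.mu Y P).freeVars
    · rw [nonexpSets, if_pos hX] at h
      obtain ⟨U', V', hU'V', hV', hU, hV⟩ := h
      exact (refinesUpTo_mu hX.2 ρ (fun ρ => ih hU'V' ρ (hxy.mono_set hU))
        fun ρ z z' hz => ih hV' ρ hz).mono_set hV
    · exact refinesUpTo_of_notMem hX ρ x y V n

/-- Since `Guarded` excuses divergences, it is compositional by itself. Hence this can precede the
soundness of `fairSets`, although the two functions are defined by mutual recursion. -/
theorem guarded_of_mem_guardSets (P : Term α ν) {V : Set α} (h : V ∈ guardSets P)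
    (ρ : ν → Model α) : Guarded V (P.denote ρ) := by
  induction P generalizing V ρ with
  | STOP => exact .deadlock V
  | SKIP => rw [guardSets] at h; exact h.elim
  | DIV => rw [guardSets] at h; exact h.elim
  | var Y => rw [guardSets] at h; exact h.elim
  | pre a P ih =>
    rw [guardSets] at h
    exact h.elim (fun h => .pre a (ih h ρ)) fun h => .pre_of_mem (show a ∈ V from h) _
  | intChoice P Q ihP ihQ =>
    rw [guardSets] at h
    exact .choice (ihP h.1 ρ) (ihQ h.2 ρ)
  | extChoice P Q ihP ihQ =>
    rw [guardSets] at h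
    exact .choice (ihP h.1 ρ) (ihQ h.2 ρ)
  | par A P Q ihP ihQ =>
    refine .par A ?_
    rw [guardSets] at h
    split_ifs at h
    · exact h.imp (ihP · ρ) (ihQ · ρ)
    · exact .inl (ihP h.1 ρ)
  | seq P Q ihP ihQ =>
    refine .seq ?_
    rw [guardSets] at h
    split_ifs at h
    · exact h.imp (ihP · ρ) (ihQ · ρ)
    · exact .inl (ihP h ρ)
  | hide P A ih =>
    rw [guardSets] at h
    split_ifs at h
    · obtain ⟨V', hV', hA, hV⟩ := h
      exact .hide hA hV (ih hV' ρ)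
    · exact h.elim
  | rename P R ih =>
    rw [guardSets] at h
    obtain ⟨V', hV', hR⟩ := h
    exact .rename hR (ih hV' ρ)
  | mu X P ih =>
    rw [guardSets] at h
    rw [← denote_mu]
    exact ih h _

theorem refinesUpTo_of_mem_contrSets (P : Term α ν) {X : ν} {U V : Set α}
    (h : (U, V) ∈ contrSets X P) (ρ : ν → Model α) {n : ℕ} {x y : Model α}
    (hxy : RefinesUpTo U n x y) :
    RefinesUpTo V (n + 1) (P.denote (Function.update ρ X x))
      (P.denote (Function.update ρ X y)) := by
  induction P generalizing X U V ρ n x y with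
  | STOP => exact .refl _ _ _
  | SKIP => exact .refl _ _ _
  | DIV => exact .refl _ _ _
  | pre a P ih =>
    by_cases hX : X ∈ (Term.pre a P).freeVars
    · rw [contrSets, if_pos hX] at h
      exact h.elim (fun h => .pre a (ih h ρ hxy))
        fun h => .pre_succ h.2 (P.refinesUpTo_of_mem_nonexpSets h.1 ρ hxy)
    · exact refinesUpTo_of_notMem hX ρ x y V _
  | intChoice P Q ihP ihQ =>
    by_cases hX : X ∈ (Term.intChoice P Q).freeVars
    · rw [contrSets, if_pos hX] at h
      exact .choice (ihP h.1 ρ hxy) (ihQ h.2 ρ hxy)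
    · exact refinesUpTo_of_notMem hX ρ x y V _
  | extChoice P Q ihP ihQ =>
    by_cases hX : X ∈ (Term.extChoice P Q).freeVars
    · rw [contrSets, if_pos hX] at h
      exact .choice (ihP h.1 ρ hxy) (ihQ h.2 ρ hxy)
    · exact refinesUpTo_of_notMem hX ρ x y V _
  | par A P Q ihP ihQ =>
    by_cases hX : X ∈ (Term.par A P Q).freeVars
    · rw [contrSets, if_pos hX] at h
      exact .par A (ihP h.1 ρ hxy) (ihQ h.2 ρ hxy)
    · exact refinesUpTo_of_notMem hX ρ x y V _
  | seq P Q ihP ihQ =>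
    by_cases hX : X ∈ (Term.seq P Q).freeVars
    · rw [contrSets, if_pos hX] at h
      obtain ⟨hP, hQ | ⟨hQ, hG⟩⟩ := h
      · exact .seq (ihP hP ρ hxy) (ihQ hQ ρ hxy)
      · exact .seq_of_guarded (P.guarded_of_mem_guardSets hG _) (ihP hP ρ hxy)
          (Q.refinesUpTo_of_mem_nonexpSets hQ ρ hxy)
    · exact refinesUpTo_of_notMem hX ρ x y V _
  | hide P A ih =>
    by_cases hX : X ∈ (Term.hide P A).freeVars
    · rw [contrSets, if_pos hX] at h
      obtain ⟨V', hV', hA, hV⟩ := h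
      exact .hide hA hV (ih hV' ρ hxy)
    · exact refinesUpTo_of_notMem hX ρ x y V _
  | rename P R ih =>
    by_cases hX : X ∈ (Term.rename P R).freeVars
    · rw [contrSets, if_pos hX] at h
      obtain ⟨V', hV', hR⟩ := h
      exact .rename hR (ih hV' ρ hxy)
    · exact refinesUpTo_of_notMem hX ρ x y V _
  | var Y =>
    by_cases hX : X ∈ (Term.var Y : Term α ν).freeVars
    · rw [contrSets, if_pos hX] at h
      exact h.elim
    · exact refinesUpTo_of_notMem hX ρ x y V _
  | mu Y P ih =>
    by_cases hX : X ∈ (Term.mu Y P).freeVars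
    · rw [contrSets, if_pos hX] at h
      obtain ⟨U', V', hU'V', hV', hU, hV⟩ := h
      -- Contraction in `X` reaches level `n + 1`; in `Y` that level has only to be preserved, hence
      -- the nonexpansive condition.
      exact (refinesUpTo_mu hX.2 ρ (fun ρ => ih hU'V' ρ (hxy.mono_set hU))
        fun ρ z z' hz => P.refinesUpTo_of_mem_nonexpSets hV' ρ hz).mono_set hV
    · exact refinesUpTo_of_notMem hX ρ x y V _

/-- A recursion is fair if its body is contractive and preserves fairness. -/
theorem fair_mu {P : Term α ν} {X : ν} {W : Set α} (hC : (W, W) ∈ contrSets X P)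
    (ρ : ν → Model α)
    (hF : ∀ x, Fair W x → Fair W (P.denote (Function.update ρ X x))) :
    Fair W ((mu X P).denote ρ) :=
  Fair.of_fixedPoint (denote_mu X P ρ) hF
    fun _ _ _ hxy => P.refinesUpTo_of_mem_contrSets hC ρ hxy

theorem fair_of_mem_fairSets (P : Term α ν) {U V : Set α} (h : (U, V) ∈ fairSets P)
    (ρ : ν → Model α) (hρ : ∀ X ∈ P.freeVars, Fair U (ρ X)) : Fair V (P.denote ρ) := by
  induction P generalizing U V ρ with
  | STOP => exact .deadlock V
  | SKIP => exact .skip V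
  | DIV => rw [fairSets] at h; exact h.elim
  | var Y =>
    rw [fairSets] at h
    exact (hρ Y rfl).mono h
  | pre a P ih =>
    rw [fairSets] at h
    exact .pre a (ih h ρ hρ)
  | intChoice P Q ihP ihQ =>
    rw [fairSets] at h
    exact .choice (ihP h.1 ρ fun X hX => hρ X (.inl hX)) (ihQ h.2 ρ fun X hX => hρ X (.inr hX))
  | extChoice P Q ihP ihQ =>
    rw [fairSets] at h
    exact .choice (ihP h.1 ρ fun X hX => hρ X (.inl hX)) (ihQ h.2 ρ fun X hX => hρ X (.inr hX))
  | seq P Q ihP ihQ =>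
    rw [fairSets] at h
    exact .seq (ihP h.1 ρ fun X hX => hρ X (.inl hX)) (ihQ h.2 ρ fun X hX => hρ X (.inr hX))
  | par A P Q ihP ihQ =>
    rw [fairSets] at h
    rcases h with (h | ⟨U₁, U₂, W, hP, hQ, he⟩) | ⟨U₁, U₂, W, hQ, hP, he⟩
    · exact .par A (ihP h.1 ρ fun X hX => hρ X (.inl hX))
        (ihQ h.2 ρ fun X hX => hρ X (.inr hX))
    · obtain ⟨rfl, rfl⟩ := Prod.mk.inj he
      exact .par_of_sync_right
        (ihP hP ρ fun X hX => (hρ X (.inl hX)).mono Set.inter_subset_left)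
        (ihQ hQ ρ fun X hX => (hρ X (.inr hX)).mono Set.inter_subset_right)
    · obtain ⟨rfl, rfl⟩ := Prod.mk.inj he
      exact .par_of_sync_left
        (ihP hP ρ fun X hX => (hρ X (.inl hX)).mono Set.inter_subset_left)
        (ihQ hQ ρ fun X hX => (hρ X (.inr hX)).mono Set.inter_subset_right)
  | hide P A ih =>
    rw [fairSets] at h
    obtain ⟨V', hV', hA, hV⟩ := h
    exact .hide hA hV (ih hV' ρ hρ)
  | rename P R ih =>
    rw [fairSets] at h
    obtain ⟨V', hV', hR⟩ := h
    exact .rename hR (ih hV' ρ hρ)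
  | mu Y P ih =>
    -- With one set `W` on both sides, the body maps fair values of `Y` to fair values, so the
    -- fixed-point argument applies. In the closed case no parameter remains and the constraint from
    -- `U` disappears.
    have key : ∀ W, (W, W) ∈ contrSets Y P ∩ fairSets P →
        (∀ X ∈ (mu Y P).freeVars, Fair W (ρ X)) → Fair W ((mu Y P).denote ρ) := by
      refine fun W hW hρW => fair_mu hW.1 ρ fun x hx => ih hW.2 _ fun X hX => ?_
      by_cases hXY : X = Y
      · subst hXY
        simpa using hx
      · simpa [hXY] using hρW X ⟨hX, hXY⟩
    rw [fairSets] at h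
    split_ifs at h with hc
    · obtain ⟨W, hW, hWV⟩ := h
      refine (key W hW fun X hX => ?_).mono hWV
      rw [hc] at hX
      exact hX.elim
    · obtain ⟨W, hW, hUW, hWV⟩ := h
      exact (key W hW fun X hX => (hρ X hX).mono hUW).mono hWV

end Term

end CSP

theorem theorem5p5 {α : Type*} {ν : Type*} [Finite α] [DecidableEq ν] (P : CSP.Term α ν)
    (hclosed : P.IsClosed) (hdiv : P.DivFree) (hfair : CSP.fairSets P ≠ ∅) :
    P.LivelockFree := by
  intro ρ
  obtain ⟨⟨U, V⟩, h⟩ := Set.nonempty_iff_ne_empty.2 hfair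
  refine (P.fair_of_mem_fairSets h ρ fun X hX => ?_).1
  rw [hclosed] at hX
  exact hX.elim
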